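/- Let $\mathcal N=\mathbb N^{\mathbb N}$ be the Baire space with the metric $d(x,y)=\max\{2^{-n}:x(n)\ne y(n)\}$ for $x\neq y$. Let $\overline{\mathcal N}=\mathcal N\sqcup\mathcal N^{-1}\sqcup\{e\}$ (with $(x^{-1})^{-1}=x$, $e^{-1}=e$) carry the extension of $d$ with $d(x^{-1},y^{-1})=d(x,y)$ and $d(x^{-1},y)=d(x,e)=d(x^{-1},e)=1$ for $x,y\in\mathcal N$. A *scale* on $\overline{\mathcal N}$ is a function $\Gamma:\overline{\mathcal N}\times[0,\infty)\to[0,\infty)$ such that, for all $x$ and $r$: $\Gamma(e,r)=r$, $\Gamma(x,r)\ge r$; $\Gamma(x,r)=0$ iff $r=0$; $\Gamma(x,\cdot)$ is monotone increasing; $\lim_{r\to0}\Gamma(x,r)=0$. It is *regular* if $\Gamma(\pi_n(x),r)\le\Gamma(x,r)$ for all $x\in\overline{\mathcal N}$, $r\ge0$, $n\in\mathbb N$, where for $x\in\mathcal N$ the sequence $\pi_n(x)$ agrees with $x$ below $n$ and is $0$ from $n$ on, $\pi_n(x^{-1})=\pi_n(x)^{-1}$ and $\pi_n(e)=e$. A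 *match* on $\{m,\dots,n\}$ is a bijection $\theta$ of this set with $\theta^2=\mathrm{id}$ and without $i<j<\theta(i)<\theta(j)$. For a word $w$ of length $l+1$ over $\overline{\mathcal N}$ and a match $\theta$ on its positions $\{0,\dots,l\}$, define $N_\Gamma^\theta(w)$ recursively (the empty word having value $0$, and restricted matches being re-indexed): if $w=x$ is a single letter, $N^\theta_\Gamma(w)=d(e,x)$; if $l>0$ and $\theta(0)=k<l$, write $w=w_1w_2$ with $|w_1|=k+1$ and put $N^\theta_\Gamma(w)=N^{\theta\restriction\{0,\dots,k\}}_\Gamma(w_1)+N^{\theta\restriction\{k+1,\dots,l\}}_\Gamma(w_2)$; if $l>0$ and $\theta(0)=l$, write $w=x^{-1}w_1y$ with letters $x,y$ and put $N^\theta_\Gamma(w)=d(x,y)+\max\{\Gamma(x,a),\Gamma(y,a)\}$, where $a=N_\Gamma^{\theta\restriction\{1,\dots,l-1\}}(w_1)$. For $u$ in the free group $F(\mathcal N)$ let $N_\Gamma(u)$ be the infimum of $N_\Gamma^\theta(w)$ over all nonempty words $w$ over $\overline{\mathcal N}$ representing $u$ and all matches $\theta$ on the positions of $w$. Let $\delta_\Gamma(u,v)=N_\Gamma(u^{-1}v)$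 and $d_\Gamma(u,v)=\delta_\Gamma(u,v)+\delta_\Gamma(u^{-1},v^{-1})$, and let $\overline F_\Gamma(\mathcal N)$ be the completion of $(F(\mathcal N),d_\Gamma)$, a Polish group under the continuous extensions of the group operations. **Theorem.** Let $\Gamma$ be a regular scale on $\overline{\mathcal N}$ (for instance Ding's, for which $\overline F_\Gamma(\mathcal N)$ is a surjectively universal Polish group). Then $\overline F_\Gamma(\mathcal N)$ is not a universal Polish group, that is, it is not the case that every Polish group admits an injective continuous homomorphism into $\overline F_\Gamma(\mathcal N)$ with closed image. Indeed $(\mathbb R,+)$ admits no injective continuous homomorphism into $\overline F_\Gamma(\mathcal N)$. -/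

import Mathlib

open Filter Topology Set
open scoped NNReal

/-! ### The alphabet `X ∪ X⁻¹ ∪ {e}` -/

/-- The alphabet `X ∪ X⁻¹ ∪ {e}` (a disjoint union): `pos x` is `x`, `neg x` is `x⁻¹`. -/
inductive Letter (X : Type*) where
  | e : Letter X
  | pos : X → Letter X
  | neg : X → Letter X

namespace Letter

variable {X : Type*}

/-- The formal inverse of a letter. -/
instance : Inv (Letter X) where
  inv
    | e => e
    | pos x => neg x
    | neg x => pos x

@[simp] theorem inv_inv' (x : Letter X) : x⁻¹⁻¹ = x := by cases x <;> rfl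

/-- The element of the free group that a letter stands for. -/
def toFree : Letter X → FreeGroup X
  | e => 1
  | pos x => FreeGroup.of x
  | neg x => (FreeGroup.of x)⁻¹

@[simp] theorem toFree_inv (x : Letter X) : (x⁻¹).toFree = x.toFree⁻¹ := by
  cases x
  · exact inv_one.symm
  · rfl
  · exact (_root_.inv_inv _).symm

/-- The extension of the metric of `X` to the alphabet:
`d (x⁻¹, y⁻¹) = d (x, y)` and `d (x⁻¹, y) = d (x, e) = d (x⁻¹, e) = 1`.
(It is a metric when the metric of `X` is bounded by `1`.) -/
def d [MetricSpace X] : Letter X → Letter X → ℝ≥0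
  | e, e => 0
  | pos x, pos y => nndist x y
  | neg x, neg y => nndist x y
  | _, _ => 1

variable [MetricSpace X]

@[simp] theorem d_self (x : Letter X) : d x x = 0 := by cases x <;> simp [d]

theorem d_comm (x y : Letter X) : d x y = d y x := by
  cases x <;> cases y <;> simp [d, nndist_comm]

@[simp] theorem d_e_inv (x : Letter X) : d e x⁻¹ = d e x := by cases x <;> rfl

/-- The action of a map of `X` on letters: `x ↦ f x`, `x⁻¹ ↦ (f x)⁻¹`, `e ↦ e`. -/
def map {Y : Type*} (f : X → Y) : Letter X → Letter Y
  | e => e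
  | pos x => pos (f x)
  | neg x => neg (f x)

end Letter

/-- The element of the free group represented by a word over `X ∪ X⁻¹ ∪ {e}`. -/
def wordVal {X : Type*} (w : List (Letter X)) : FreeGroup X := (w.map Letter.toFree).prod

/-! ### Scales, matches and the norm `N_Γ` -/

/-- A scale on the alphabet `X ∪ X⁻¹ ∪ {e}`. -/
structure LetterScale (X : Type*) where
  toFun : Letter X → ℝ≥0 → ℝ≥0
  e_eq : ∀ r, toFun Letter.e r = r
  le_self : ∀ x r, r ≤ toFun x r
  eq_zero_iff : ∀ x r, toFun x r = 0 ↔ r = 0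
  mono : ∀ x, Monotone (toFun x)
  tendsto_zero : ∀ x, Tendsto (toFun x) (𝓝 0) (𝓝 0)

/-- `θ` is a match on `{m, …, n - 1}`: a bijection of this set with `θ² = id` and without
crossings `i < j < θ i < θ j`. (The values of `θ` outside this set are irrelevant.) -/
structure IsMatch (m n : ℕ) (θ : ℕ → ℕ) : Prop where
  bij : BijOn θ (Ico m n) (Ico m n)
  invol : ∀ i ∈ Ico m n, θ (θ i) = i
  noncross : ¬ ∃ i ∈ Ico m n, ∃ j ∈ Ico m n, i < j ∧ j < θ i ∧ θ i < θ j

/-- `N_Γ^θ (w)`, where the letters of `w` occupy the positions `m, m + 1, …, m + |w| - 1` and `θ` is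
a match on this set of positions; the empty word has value `0`. If the partner of the first letter
is not the last letter, the word is split after this partner; otherwise
`w = x⁻¹ w₁ y` and the value is `d (x, y) + max {Γ (x, N (w₁)), Γ (y, N (w₁))}`. -/
noncomputable def matchNorm {X : Type*} [MetricSpace X] (Γ : LetterScale X) (θ : ℕ → ℕ) :
    ℕ → List (Letter X) → ℝ≥0
  | _, [] => 0
  | _, [x] => Letter.d Letter.e x
  | m, a :: b :: t =>
    if θ m - m < t.length + 1 then
      matchNorm Γ θ m ((a :: b :: t).take (θ m - m + 1)) +
        matchNorm Γ θ (m + (θ m - m + 1)) ((a :: b :: t).drop (θ m - m + 1))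
    else
      Letter.d a⁻¹ ((b :: t).getLast (List.cons_ne_nil b t)) +
        max (Γ.toFun a⁻¹ (matchNorm Γ θ (m + 1) (b :: t).dropLast))
          (Γ.toFun ((b :: t).getLast (List.cons_ne_nil b t))
            (matchNorm Γ θ (m + 1) (b :: t).dropLast))
termination_by _ w => w.length
decreasing_by
  all_goals simp
  all_goals omega

/-- `N_Γ (u)`: the infimum of `N_Γ^θ (w)` over all nonempty words `w` representing `u` and all
matches `θ` on the positions of `w`. -/
noncomputable def scaleNorm {X : Type*} [MetricSpace X] (Γ : LetterScale X) (u : FreeGroup X) :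
    ℝ≥0 :=
  sInf {c | ∃ w : List (Letter X), w ≠ [] ∧ wordVal w = u ∧
    ∃ θ : ℕ → ℕ, IsMatch 0 w.length θ ∧ c = matchNorm Γ θ 0 w}

/-! ### Basic facts on `N_Γ`, needed for the group structure of the completion -/

section norm

variable {X : Type*}

@[simp] theorem wordVal_nil : wordVal ([] : List (Letter X)) = 1 := rfl

@[simp] theorem wordVal_cons (a : Letter X) (w : List (Letter X)) :
    wordVal (a :: w) = a.toFree * wordVal w := by simp [wordVal]

@[simp] theorem wordVal_append (v w : List (Letter X)) :
    wordVal (v ++ w) = wordVal v * wordVal w := by simp [wordVal]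

theorem wordVal_reverse (w : List (Letter X)) :
    wordVal (w.map (·⁻¹)).reverse = (wordVal w)⁻¹ := by
  induction w with
  | nil => simp
  | cons a w ih => simp [ih]

theorem exists_word (u : FreeGroup X) : ∃ w : List (Letter X), wordVal w = u := by
  refine FreeGroup.induction_on u ⟨[], rfl⟩ (fun x => ⟨[.pos x], by simp [Letter.toFree]⟩)
    (fun x _ => ⟨[.neg x], by simp [Letter.toFree]⟩) ?_
  rintro x y ⟨v, rfl⟩ ⟨w, rfl⟩
  exact ⟨v ++ w, wordVal_append v w⟩

theorem IsMatch.mem {m n : ℕ} {θ : ℕ → ℕ} (h : IsMatch m n θ) {i : ℕ} (h1 : m ≤ i) (h2 : i < n) :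
    m ≤ θ i ∧ θ i < n := h.bij.mapsTo ⟨h1, h2⟩

theorem IsMatch.of_forall {m n : ℕ} {θ : ℕ → ℕ}
    (h1 : ∀ i, m ≤ i → i < n → m ≤ θ i ∧ θ i < n ∧ θ (θ i) = i)
    (h2 : ∀ i j, m ≤ i → i < j → j < θ i → θ i < θ j → j < n → False) : IsMatch m n θ where
  bij := by
    refine ⟨fun i hi => ?_, fun i hi j hj hij => ?_, fun i hi => ?_⟩
    · exact ⟨(h1 i hi.1 hi.2).1, (h1 i hi.1 hi.2).2.1⟩
    · rw [← (h1 i hi.1 hi.2).2.2, hij, (h1 j hj.1 hj.2).2.2]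
    · exact ⟨θ i, ⟨(h1 i hi.1 hi.2).1, (h1 i hi.1 hi.2).2.1⟩, (h1 i hi.1 hi.2).2.2⟩
  invol i hi := (h1 i hi.1 hi.2).2.2
  noncross := by
    rintro ⟨i, hi, j, hj, a, b, c⟩
    exact h2 i j hi.1 a b c hj.2

theorem IsMatch.cross {m n : ℕ} {θ : ℕ → ℕ} (h : IsMatch m n θ) {i j : ℕ} (hi : m ≤ i)
    (hij : i < j) (hj : j < n) (h1 : j < θ i) (h2 : θ i < θ j) : False :=
  h.noncross ⟨i, ⟨hi, hij.trans hj⟩, j, ⟨hi.trans hij.le, hj⟩, hij, h1, h2⟩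

theorem IsMatch.inv_eq {m n : ℕ} {θ : ℕ → ℕ} (h : IsMatch m n θ) {i : ℕ} (h1 : m ≤ i)
    (h2 : i < n) : θ (θ i) = i := h.invol i ⟨h1, h2⟩

theorem IsMatch.left {m n : ℕ} {θ : ℕ → ℕ} (h : IsMatch m n θ) (hmn : m < n) :
    IsMatch m (θ m + 1) θ := by
  have hm := h.mem le_rfl hmn
  refine .of_forall (fun i h1 h2 => ?_) (fun i j h1 h2 h3 h4 h5 => ?_)
  · have hi : i < n := by omega
    have h3 := h.mem h1 hi
    refine ⟨h3.1, ?_, h.inv_eq h1 hi⟩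
    by_contra hc
    rcases eq_or_lt_of_le h1 with rfl | h1'
    · omega
    rcases eq_or_lt_of_le (Nat.lt_succ_iff.1 h2) with rfl | h2'
    · rw [h.inv_eq le_rfl hmn] at hc
      omega
    · exact h.cross le_rfl h1' hi h2' (by omega)
  · exact h.cross h1 h2 (by omega) h3 h4

theorem IsMatch.right {m n : ℕ} {θ : ℕ → ℕ} (h : IsMatch m n θ) (hmn : m < n) :
    IsMatch (θ m + 1) n θ := by
  have hm := h.mem le_rfl hmn
  have hl := h.left hmn
  refine .of_forall (fun i h1 h2 => ?_) (fun i j h1 h2 h3 h4 h5 => ?_)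
  · have h3 := h.mem (by omega) h2
    refine ⟨?_, h3.2, h.inv_eq (by omega) h2⟩
    by_contra hc
    have h4 := hl.mem h3.1 (by omega)
    rw [h.inv_eq (by omega) h2] at h4
    omega
  · exact h.cross (by omega) h2 h5 h3 h4

theorem IsMatch.inner {m n : ℕ} {θ : ℕ → ℕ} (h : IsMatch m n θ) (hmn : m + 1 < n)
    (hθ : θ m = n - 1) : IsMatch (m + 1) (n - 1) θ := by
  have h0 : θ (n - 1) = m := by rw [← hθ, h.inv_eq le_rfl (by omega)]
  refine .of_forall (fun i h1 h2 => ?_) (fun i j h1 h2 h3 h4 h5 => ?_)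
  · have h3 := h.mem (by omega) (by omega : i < n)
    have h4 := h.inv_eq (by omega) (by omega : i < n)
    refine ⟨?_, ?_, h4⟩
    · by_contra hc
      have : θ i = m := by omega
      rw [this] at h4
      omega
    · by_contra hc
      have : θ i = n - 1 := by omega
      rw [this] at h4
      omega
  · exact h.cross (by omega) h2 (by omega) h3 h4

variable [MetricSpace X] (Γ : LetterScale X)

theorem matchNorm_nil (θ : ℕ → ℕ) (m : ℕ) : matchNorm Γ θ m [] = 0 := by
  rw [matchNorm]

theorem matchNorm_singleton (θ : ℕ → ℕ) (m : ℕ) (x : Letter X) :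
    matchNorm Γ θ m [x] = Letter.d Letter.e x := by
  rw [matchNorm]

theorem matchNorm_split (θ : ℕ → ℕ) (m : ℕ) (w : List (Letter X)) (h : θ m - m < w.length) :
    matchNorm Γ θ m w = matchNorm Γ θ m (w.take (θ m - m + 1)) +
      matchNorm Γ θ (m + (θ m - m + 1)) (w.drop (θ m - m + 1)) := by
  match w, h with
  | [x], h => simp [matchNorm_nil]
  | a :: b :: t, h =>
    by_cases hk : θ m - m < t.length + 1
    · rw [matchNorm, if_pos hk]
    · have : θ m - m = t.length + 1 := by simp at h; omega
      rw [this]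
      simp [matchNorm_nil]

theorem matchNorm_wrap (θ : ℕ → ℕ) (m : ℕ) (w : List (Letter X)) (x y : Letter X)
    (h : θ m = m + w.length + 1) :
    matchNorm Γ θ m (x⁻¹ :: (w ++ [y])) = Letter.d x y +
      max (Γ.toFun x (matchNorm Γ θ (m + 1) w)) (Γ.toFun y (matchNorm Γ θ (m + 1) w)) := by
  cases w with
  | nil =>
    simp only [List.length_nil] at h
    simp [matchNorm, h]
  | cons b t =>
    simp only [List.length_cons] at h
    have h1 : ¬ (θ m - m < (t ++ [y]).length + 1) := by simp; omega
    have h2 : (b :: (t ++ [y])) = (b :: t) ++ [y] := rfl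
    rw [List.cons_append, matchNorm, if_neg h1]
    simp only [h2, List.getLast_append_singleton, List.dropLast_concat, Letter.inv_inv']

/-- The pairs `(w, N_Γ^θ (w))`, generated inductively. -/
inductive MatchCost : List (Letter X) → ℝ≥0 → Prop
  | nil : MatchCost [] 0
  | single (x : Letter X) : MatchCost [x] (Letter.d Letter.e x)
  | app {v w : List (Letter X)} {a b : ℝ≥0} :
      MatchCost v a → MatchCost w b → MatchCost (v ++ w) (a + b)
  | wrap {w : List (Letter X)} {a : ℝ≥0} (x y : Letter X) : MatchCost w a →
      MatchCost (x⁻¹ :: (w ++ [y])) (Letter.d x y + max (Γ.toFun x a) (Γ.toFun y a))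

theorem matchCost_matchNorm (θ : ℕ → ℕ) (w : List (Letter X)) (m : ℕ)
    (h : IsMatch m (m + w.length) θ) : MatchCost Γ w (matchNorm Γ θ m w) := by
  induction hn : w.length using Nat.strong_induction_on generalizing w m with
  | _ n ih =>
  match w, h, hn with
  | [], h, hn => rw [matchNorm_nil]; exact .nil
  | [x], h, hn => rw [matchNorm_singleton]; exact .single x
  | a :: b :: t, h, hn =>
    simp only [List.length_cons] at h hn
    have hm := h.mem le_rfl (by omega)
    by_cases hk : θ m - m < t.length + 1
    · rw [matchNorm_split Γ θ m _ (by simp; omega)]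
      conv => enter [2]; rw [← List.take_append_drop (θ m - m + 1) (a :: b :: t)]
      refine .app (ih (θ m - m + 1) (by omega) _ _ ?_ ?_)
        (ih (t.length + 2 - (θ m - m + 1)) (by omega) _ _ ?_ ?_)
      · have := h.left (by omega)
        convert this using 1
        simp
        omega
      · simp; omega
      · have := h.right (by omega)
        convert this using 1
        · omega
        · simp; omega
      · simp
    · have e1 : b :: t = (b :: t).dropLast ++ [(b :: t).getLast (List.cons_ne_nil b t)] :=
        (List.dropLast_append_getLast _).symm
      have e2 : θ m = m + (b :: t).dropLast.length + 1 := by simp; omega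
      have e3 := matchNorm_wrap Γ θ m (b :: t).dropLast a⁻¹
        ((b :: t).getLast (List.cons_ne_nil b t)) e2
      rw [← e1, Letter.inv_inv'] at e3
      rw [e3]
      have e4 : MatchCost Γ (b :: t).dropLast (matchNorm Γ θ (m + 1) (b :: t).dropLast) := by
        refine ih t.length (by omega) _ _ ?_ (by simp)
        have := h.inner (by omega) (by omega)
        convert this using 1
        simp
        omega
      have e5 := MatchCost.wrap a⁻¹ ((b :: t).getLast (List.cons_ne_nil b t)) e4
      rwa [← e1, Letter.inv_inv'] at e5

theorem matchNorm_congr (θ η : ℕ → ℕ) (w : List (Letter X)) (m : ℕ)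
    (h : IsMatch m (m + w.length) θ) (he : ∀ i, m ≤ i → i < m + w.length → θ i = η i) :
    matchNorm Γ θ m w = matchNorm Γ η m w := by
  induction hn : w.length using Nat.strong_induction_on generalizing w m with
  | _ n ih =>
  match w, h, he, hn with
  | [], h, he, hn => simp [matchNorm_nil]
  | [x], h, he, hn => simp [matchNorm_singleton]
  | a :: b :: t, h, he, hn =>
    simp only [List.length_cons] at h he hn
    have hm := h.mem le_rfl (by omega)
    have hem := he m le_rfl (by omega)
    by_cases hk : θ m - m < t.length + 1
    · rw [matchNorm_split Γ θ m _ (by simp; omega), matchNorm_split Γ η m _ (by simp; omega),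
        ← hem]
      congr 1
      · refine ih (θ m - m + 1) (by omega) _ _ ?_ (fun i h1 h2 => he i h1 ?_) ?_
        · have := h.left (by omega)
          convert this using 1
          simp
          omega
        · simp at h2; omega
        · simp; omega
      · refine ih (t.length + 2 - (θ m - m + 1)) (by omega) _ _ ?_
          (fun i h1 h2 => he i (by omega) ?_) ?_
        · have := h.right (by omega)
          convert this using 1
          · omega
          · simp; omega
        · simp at h2; omega
        · simp
    · have e4 : matchNorm Γ θ (m + 1) (b :: t).dropLast =
          matchNorm Γ η (m + 1) (b :: t).dropLast := by
        refine ih t.length (by omega) _ _ ?_ (fun i h1 h2 => he i (by omega) ?_) (by simp)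
        · have := h.inner (by omega) (by omega)
          convert this using 1
          simp
          omega
        · simp at h2; omega
      rw [matchNorm, matchNorm, if_neg hk, if_neg (by rwa [← hem]), e4]

theorem matchNorm_append (θ : ℕ → ℕ) (v w : List (Letter X)) (m : ℕ)
    (h : IsMatch m (m + v.length) θ) :
    matchNorm Γ θ m (v ++ w) = matchNorm Γ θ m v + matchNorm Γ θ (m + v.length) w := by
  induction hn : v.length using Nat.strong_induction_on generalizing v m with
  | _ n ih =>
  rcases Nat.eq_zero_or_pos n with h0 | h0
  · have : v = [] := List.length_eq_zero_iff.1 (by omega)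
    subst this
    simp [matchNorm_nil, h0]
  · have hm := h.mem le_rfl (by omega)
    have hr := h.right (by omega)
    rw [matchNorm_split Γ θ m (v ++ w) (by simp; omega), matchNorm_split Γ θ m v (by omega),
      List.take_append_of_le_length (by omega), List.drop_append_of_le_length (by omega),
      ih (n - (θ m - m + 1)) (by omega) _ _ _ (by simp; omega)]
    · have e : m + (θ m - m + 1) + (n - (θ m - m + 1)) = m + n := by omega
      rw [e, add_assoc]
    · convert hr using 1
      · omega
      · simp; omega

theorem MatchCost.exists_match {w : List (Letter X)} {c : ℝ≥0} (h : MatchCost Γ w c) (m : ℕ) :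
    ∃ θ : ℕ → ℕ, IsMatch m (m + w.length) θ ∧ c = matchNorm Γ θ m w := by
  induction h generalizing m with
  | nil =>
    exact ⟨id, .of_forall (fun i h1 h2 => by simp at h2; omega)
      (fun i j h1 h2 h3 h4 h5 => by simp at h3; omega), (matchNorm_nil Γ _ _).symm⟩
  | single x =>
    exact ⟨id, .of_forall (fun i h1 h2 => ⟨h1, h2, rfl⟩)
      (fun i j h1 h2 h3 h4 h5 => by simp at h3; omega), (matchNorm_singleton Γ _ _ _).symm⟩
  | @app v w a b hv hw ihv ihw =>
    obtain ⟨θ, h1, e1⟩ := ihv m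
    obtain ⟨η, h2, e2⟩ := ihw (m + v.length)
    set ζ : ℕ → ℕ := fun i => if i < m + v.length then θ i else η i with hζ
    have z1 : ∀ i, i < m + v.length → ζ i = θ i := fun i hi => if_pos hi
    have z2 : ∀ i, m + v.length ≤ i → ζ i = η i := fun i hi => if_neg (by omega)
    have h1' : IsMatch m (m + v.length) ζ := by
      refine .of_forall (fun i a1 a2 => ?_) (fun i j a1 a2 a3 a4 a5 => ?_)
      · have := h1.mem a1 a2
        rw [z1 i a2, z1 _ this.2]
        exact ⟨this.1, this.2, h1.inv_eq a1 a2⟩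
      · rw [z1 i (by omega)] at a3 a4
        rw [z1 j (by omega)] at a4
        exact h1.cross a1 a2 a5 a3 a4
    refine ⟨ζ, .of_forall (fun i a1 a2 => ?_) (fun i j a1 a2 a3 a4 a5 => ?_), ?_⟩
    · simp only [List.length_append] at a2 ⊢
      by_cases hi : i < m + v.length
      · have := h1'.mem a1 hi
        exact ⟨this.1, by omega, h1'.inv_eq a1 hi⟩
      · have := h2.mem (by omega : m + v.length ≤ i) (by omega)
        rw [z2 i (by omega), z2 _ this.1]
        exact ⟨by omega, by omega, h2.inv_eq (by omega) (by omega)⟩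
    · simp only [List.length_append] at a5
      by_cases hj : j < m + v.length
      · exact h1'.cross a1 a2 hj a3 a4
      · by_cases hi : i < m + v.length
        · have := h1'.mem a1 hi
          omega
        · rw [z2 i (by omega)] at a3 a4
          rw [z2 j (by omega)] at a4
          exact h2.cross (by omega) a2 (by omega) a3 a4
    · rw [matchNorm_append Γ ζ v w m h1', e1, e2,
        matchNorm_congr Γ θ ζ v m h1 (fun i _ hi => (z1 i hi).symm),
        matchNorm_congr Γ η ζ w _ h2 (fun i hi _ => (z2 i hi).symm)]
  | @wrap w a x y hw ih =>
    obtain ⟨θ, h1, e1⟩ := ih (m + 1)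
    set ζ : ℕ → ℕ := fun i => if i = m then m + w.length + 1 else
      if i = m + w.length + 1 then m else θ i with hζ
    have z1 : ζ m = m + w.length + 1 := if_pos rfl
    have z2 : ζ (m + w.length + 1) = m := by simp [hζ]
    have z3 : ∀ i, m + 1 ≤ i → i < m + 1 + w.length → ζ i = θ i := fun i a1 a2 => by
      simp only [hζ]
      rw [if_neg (by omega), if_neg (by omega)]
    refine ⟨ζ, .of_forall (fun i a1 a2 => ?_) (fun i j a1 a2 a3 a4 a5 => ?_), ?_⟩
    · simp only [List.length_append, List.length_cons, List.length_nil] at a2 ⊢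
      by_cases b1 : i = m
      · subst b1
        rw [z1, z2]
        omega
      by_cases b2 : i = m + w.length + 1
      · subst b2
        rw [z2, z1]
        omega
      have := h1.mem (by omega : m + 1 ≤ i) (by omega)
      rw [z3 i (by omega) (by omega), z3 _ this.1 this.2]
      exact ⟨by omega, by omega, h1.inv_eq (by omega) (by omega)⟩
    · simp only [List.length_append, List.length_cons, List.length_nil] at a5
      by_cases c2 : j = m + w.length + 1
      · subst c2
        rw [z2] at a4
        omega
      have hj := h1.mem (by omega : m + 1 ≤ j) (by omega)
      rw [z3 j (by omega) (by omega)] at a4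
      by_cases b1 : i = m
      · subst b1
        rw [z1] at a4
        omega
      rw [z3 i (by omega) (by omega)] at a3 a4
      exact h1.cross (by omega) a2 (by omega) a3 a4
    · rw [matchNorm_wrap Γ ζ m w x y z1, e1, matchNorm_congr Γ θ ζ w (m + 1) h1
        (fun i a1 a2 => (z3 i a1 a2).symm)]

theorem MatchCost.reverse {w : List (Letter X)} {c : ℝ≥0} (h : MatchCost Γ w c) :
    MatchCost Γ (w.map (·⁻¹)).reverse c := by
  induction h with
  | nil => exact .nil
  | single x =>
    rw [← Letter.d_e_inv]
    exact .single x⁻¹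
  | app _ _ ihv ihw =>
    rw [List.map_append, List.reverse_append, add_comm]
    exact .app ihw ihv
  | @wrap w a x y _ ih =>
    have := MatchCost.wrap y x ih
    rw [Letter.d_comm, max_comm] at this
    simpa using this

theorem exists_matchCost (w : List (Letter X)) : ∃ c, MatchCost Γ w c := by
  induction w with
  | nil => exact ⟨0, .nil⟩
  | cons a w ih =>
    obtain ⟨c, hc⟩ := ih
    exact ⟨_, (MatchCost.single a).app hc⟩

theorem scaleNorm_le {w : List (Letter X)} {c : ℝ≥0} (h : MatchCost Γ w c) :
    scaleNorm Γ (wordVal w) ≤ c := by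
  have h2 : MatchCost Γ (w ++ [Letter.e]) (c + Letter.d Letter.e Letter.e) := h.app (.single _)
  rw [Letter.d_self, add_zero] at h2
  obtain ⟨θ, hθ, hc⟩ := h2.exists_match Γ 0
  rw [zero_add] at hθ
  exact csInf_le (OrderBot.bddBelow _) ⟨w ++ [.e], by simp, by simp [Letter.toFree], θ, hθ, hc⟩

theorem exists_matchCost_lt {u : FreeGroup X} {r : ℝ≥0} (h : scaleNorm Γ u < r) :
    ∃ w c, MatchCost Γ w c ∧ wordVal w = u ∧ c < r := by
  have hne : {c | ∃ w : List (Letter X), w ≠ [] ∧ wordVal w = u ∧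
      ∃ θ : ℕ → ℕ, IsMatch 0 w.length θ ∧ c = matchNorm Γ θ 0 w}.Nonempty := by
    obtain ⟨w, rfl⟩ := exists_word u
    obtain ⟨c, hc⟩ := exists_matchCost Γ (w ++ [Letter.e])
    obtain ⟨θ, hθ, hc⟩ := hc.exists_match Γ 0
    rw [zero_add] at hθ
    exact ⟨c, w ++ [.e], by simp, by simp [Letter.toFree], θ, hθ, hc⟩
  obtain ⟨c, ⟨w, -, hw, θ, hθ, rfl⟩, hc⟩ := exists_lt_of_csInf_lt hne h
  exact ⟨w, _, matchCost_matchNorm Γ θ w 0 (by rwa [zero_add]), hw, hc⟩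

theorem scaleNorm_one : scaleNorm Γ (1 : FreeGroup X) = 0 :=
  le_antisymm (scaleNorm_le Γ MatchCost.nil) bot_le

theorem scaleNorm_mul_le (u v : FreeGroup X) :
    scaleNorm Γ (u * v) ≤ scaleNorm Γ u + scaleNorm Γ v := by
  refine le_of_forall_gt_imp_ge_of_dense fun r hr => ?_
  obtain ⟨ε, hε, rfl⟩ : ∃ ε, 0 < ε ∧ r = scaleNorm Γ u + scaleNorm Γ v + ε :=
    ⟨r - (scaleNorm Γ u + scaleNorm Γ v), tsub_pos_of_lt hr, (add_tsub_cancel_of_le hr.le).symm⟩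
  obtain ⟨w₁, c₁, h₁, rfl, l₁⟩ := exists_matchCost_lt Γ (lt_add_of_pos_right (scaleNorm Γ u)
    (half_pos hε))
  obtain ⟨w₂, c₂, h₂, rfl, l₂⟩ := exists_matchCost_lt Γ (lt_add_of_pos_right (scaleNorm Γ v)
    (half_pos hε))
  rw [← wordVal_append]
  calc _ ≤ c₁ + c₂ := scaleNorm_le Γ (h₁.app h₂)
    _ ≤ _ := (add_lt_add l₁ l₂).le
    _ = _ := by rw [add_add_add_comm, add_halves]

theorem scaleNorm_inv_le (u : FreeGroup X) : scaleNorm Γ u⁻¹ ≤ scaleNorm Γ u := by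
  refine le_of_forall_gt fun r hr => ?_
  obtain ⟨w, c, h, rfl, l⟩ := exists_matchCost_lt Γ hr
  rw [← wordVal_reverse]
  exact (scaleNorm_le Γ (h.reverse Γ)).trans_lt l

theorem scaleNorm_inv (u : FreeGroup X) : scaleNorm Γ u⁻¹ = scaleNorm Γ u :=
  le_antisymm (scaleNorm_inv_le Γ u) (by simpa using scaleNorm_inv_le Γ u⁻¹)

theorem scaleNorm_conj_letter_le (x : Letter X) (u : FreeGroup X) {r : ℝ≥0}
    (h : scaleNorm Γ u < r) : scaleNorm Γ (x.toFree⁻¹ * u * x.toFree) ≤ Γ.toFun x r := by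
  obtain ⟨w, c, hc, rfl, l⟩ := exists_matchCost_lt Γ h
  have h1 := scaleNorm_le Γ (hc.wrap x x)
  simp only [wordVal_cons, wordVal_append, wordVal_nil, Letter.toFree_inv, mul_one,
    Letter.d_self, zero_add, max_self, ← mul_assoc] at h1
  exact h1.trans (Γ.mono x l.le)

/-- Conjugation is continuous at the identity with respect to `N_Γ`. -/
theorem scaleNorm_conj (g : FreeGroup X) (ε : ℝ≥0) (hε : 0 < ε) :
    ∃ η : ℝ≥0, 0 < η ∧ ∀ u, scaleNorm Γ u < η → scaleNorm Γ (g⁻¹ * u * g) < ε := by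
  have key : ∀ x : Letter X, ∀ ε : ℝ≥0, 0 < ε → ∃ η : ℝ≥0, 0 < η ∧
      ∀ u, scaleNorm Γ u < η → scaleNorm Γ (x.toFree⁻¹ * u * x.toFree) < ε := by
    intro x ε hε
    have h1 : ∀ᶠ r in 𝓝[>] (0 : ℝ≥0), Γ.toFun x r < ε :=
      ((Γ.tendsto_zero x).mono_left nhdsWithin_le_nhds).eventually (gt_mem_nhds hε)
    obtain ⟨r, hr, hr0⟩ := (h1.and self_mem_nhdsWithin).exists
    exact ⟨r, hr0, fun u hu => (scaleNorm_conj_letter_le Γ x u hu).trans_lt hr⟩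
  obtain ⟨w, rfl⟩ := exists_word g
  induction w generalizing ε with
  | nil => exact ⟨ε, hε, fun u hu => by simpa using hu⟩
  | cons a w ih =>
    obtain ⟨η, hη, h1⟩ := ih ε hε
    obtain ⟨η', hη', h2⟩ := key a η hη
    refine ⟨η', hη', fun u hu => ?_⟩
    have := h1 _ (h2 u hu)
    simpa [mul_assoc] using this

end norm

/-! ### The group `F_Γ(X)` and its completion -/

/-- The free group on `X`, to be equipped with the metric `d_Γ` given by the scale `Γ`. -/
def ScaledFree {X : Type*} [MetricSpace X] (_Γ : LetterScale X) : Type _ := FreeGroup X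

instance {X : Type*} [MetricSpace X] (Γ : LetterScale X) : Group (ScaledFree Γ) :=
  inferInstanceAs (Group (FreeGroup X))

/-- The identity map, forgetting the metric. -/
def ScaledFree.equiv {X : Type*} [MetricSpace X] (Γ : LetterScale X) :
    ScaledFree Γ ≃* FreeGroup X :=
  MulEquiv.refl (FreeGroup X)

/-- `δ_Γ (u, v) = N_Γ (u⁻¹ v)`. -/
noncomputable def scaleDelta {X : Type*} [MetricSpace X] (Γ : LetterScale X)
    (u v : FreeGroup X) : ℝ≥0 :=
  scaleNorm Γ (u⁻¹ * v)

theorem scaleDelta_self {X : Type*} [MetricSpace X] (Γ : LetterScale X) (u : FreeGroup X) :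
    scaleDelta Γ u u = 0 := by
  rw [scaleDelta, inv_mul_cancel, scaleNorm_one]

theorem scaleDelta_comm {X : Type*} [MetricSpace X] (Γ : LetterScale X) (u v : FreeGroup X) :
    scaleDelta Γ u v = scaleDelta Γ v u := by
  rw [scaleDelta, scaleDelta, ← scaleNorm_inv, mul_inv_rev, inv_inv]

theorem scaleDelta_triangle {X : Type*} [MetricSpace X] (Γ : LetterScale X)
    (u v w : FreeGroup X) : scaleDelta Γ u w ≤ scaleDelta Γ u v + scaleDelta Γ v w := by
  have := scaleNorm_mul_le Γ (u⁻¹ * v) (v⁻¹ * w)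
  rwa [show u⁻¹ * v * (v⁻¹ * w) = u⁻¹ * w by group] at this

/-- The (pseudo)metric `d_Γ (u, v) = δ_Γ (u, v) + δ_Γ (u⁻¹, v⁻¹)` on the free group. -/
noncomputable instance {X : Type*} [MetricSpace X] (Γ : LetterScale X) :
    PseudoMetricSpace (ScaledFree Γ) where
  dist u v := (scaleDelta Γ (ScaledFree.equiv Γ u) (ScaledFree.equiv Γ v) : ℝ) +
    scaleDelta Γ (ScaledFree.equiv Γ u)⁻¹ (ScaledFree.equiv Γ v)⁻¹
  dist_self u := by rw [scaleDelta_self, scaleDelta_self, NNReal.coe_zero, add_zero]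
  dist_comm u v := by rw [scaleDelta_comm Γ (_)⁻¹, scaleDelta_comm Γ (ScaledFree.equiv Γ u)]
  dist_triangle u v w := by
    have h := fun a b c : FreeGroup X => NNReal.coe_le_coe.2 (scaleDelta_triangle Γ a b c)
    simp only [NNReal.coe_add] at h
    linarith [h (ScaledFree.equiv Γ u) (ScaledFree.equiv Γ v) (ScaledFree.equiv Γ w),
      h (ScaledFree.equiv Γ u)⁻¹ (ScaledFree.equiv Γ v)⁻¹ (ScaledFree.equiv Γ w)⁻¹]

/-- The completion of the free group on `X` with respect to the metric `d_Γ`. -/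
def CompletedFree {X : Type*} [MetricSpace X] (Γ : LetterScale X) : Type _ :=
  UniformSpace.Completion (ScaledFree Γ)

namespace ScaledFree

variable {X : Type*} [MetricSpace X] {Γ : LetterScale X}

/-- `N_Γ` as a real-valued function on `F_Γ(X)`. -/
noncomputable def nrm (u : ScaledFree Γ) : ℝ := scaleNorm Γ u

theorem dist_def (u v : ScaledFree Γ) : dist u v = nrm (u⁻¹ * v) + nrm (u * v⁻¹) := by
  have : nrm (u * v⁻¹) = nrm (u⁻¹⁻¹ * v⁻¹) := by rw [inv_inv]
  rw [this]
  rfl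

theorem nrm_nonneg (u : ScaledFree Γ) : 0 ≤ nrm u := NNReal.coe_nonneg _

theorem nrm_mul_le (u v : ScaledFree Γ) : nrm (u * v) ≤ nrm u + nrm v := by
  exact_mod_cast scaleNorm_mul_le Γ u v

theorem nrm_inv (u : ScaledFree Γ) : nrm u⁻¹ = nrm u := by
  exact congrArg NNReal.toReal (scaleNorm_inv Γ u)

theorem nrm_conj (g : ScaledFree Γ) {ε : ℝ} (hε : 0 < ε) :
    ∃ η : ℝ, 0 < η ∧ ∀ u : ScaledFree Γ, nrm u < η → nrm (g⁻¹ * u * g) < ε := by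
  obtain ⟨η, hη, h⟩ := scaleNorm_conj Γ g ⟨ε, hε.le⟩ hε
  exact ⟨η, hη, fun u hu => h u hu⟩

theorem nrm_left_le (u v : ScaledFree Γ) : nrm (u⁻¹ * v) ≤ dist u v := by
  rw [dist_def]
  linarith [nrm_nonneg (u * v⁻¹)]

theorem nrm_right_le (u v : ScaledFree Γ) : nrm (u * v⁻¹) ≤ dist u v := by
  rw [dist_def]
  linarith [nrm_nonneg (u⁻¹ * v)]

theorem dist_inv_inv (u v : ScaledFree Γ) : dist u⁻¹ v⁻¹ = dist u v := by
  rw [dist_def, dist_def, inv_inv, inv_inv, add_comm]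

/-- Multiplication is Cauchy continuous. -/
theorem dist_mul_lt (u₀ v₀ : ScaledFree Γ) {ε : ℝ} (hε : 0 < ε) :
    ∃ η : ℝ, 0 < η ∧ ∀ u u' v v' : ScaledFree Γ, dist u₀ u < ε → dist v₀ v < ε →
      dist u u' < η → dist v v' < η → dist (u * v) (u' * v') < 8 * ε := by
  obtain ⟨η₁, p₁, h₁⟩ := nrm_conj v₀ hε
  obtain ⟨η₂, p₂, h₂⟩ := nrm_conj u₀⁻¹ hε
  refine ⟨min ε (min η₁ η₂), lt_min hε (lt_min p₁ p₂), fun u u' v v' hu hv hu' hv' => ?_⟩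
  simp only [lt_min_iff] at hu' hv'
  have a1 := h₁ (u⁻¹ * u') ((nrm_left_le _ _).trans_lt hu'.2.1)
  have a2 := h₂ (v * v'⁻¹) ((nrm_right_le _ _).trans_lt hv'.2.2)
  have b1 := nrm_left_le v₀ v
  have b2 := nrm_right_le u₀ u
  have c1 : (u * v)⁻¹ * (u' * v') =
      (v₀⁻¹ * v)⁻¹ * (v₀⁻¹ * (u⁻¹ * u') * v₀) * (v₀⁻¹ * v) * (v⁻¹ * v') := by group
  have c2 : (u * v) * (u' * v')⁻¹ =
      (u₀ * u⁻¹)⁻¹ * (u₀⁻¹⁻¹ * (v * v'⁻¹) * u₀⁻¹) * (u₀ * u⁻¹) * (u * u'⁻¹) := by group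
  have d1 := nrm_mul_le ((v₀⁻¹ * v)⁻¹ * (v₀⁻¹ * (u⁻¹ * u') * v₀) * (v₀⁻¹ * v)) (v⁻¹ * v')
  have d2 := nrm_mul_le ((v₀⁻¹ * v)⁻¹ * (v₀⁻¹ * (u⁻¹ * u') * v₀)) (v₀⁻¹ * v)
  have d3 := nrm_mul_le (v₀⁻¹ * v)⁻¹ (v₀⁻¹ * (u⁻¹ * u') * v₀)
  have e1 := nrm_mul_le ((u₀ * u⁻¹)⁻¹ * (u₀⁻¹⁻¹ * (v * v'⁻¹) * u₀⁻¹) * (u₀ * u⁻¹)) (u * u'⁻¹)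
  have e2 := nrm_mul_le ((u₀ * u⁻¹)⁻¹ * (u₀⁻¹⁻¹ * (v * v'⁻¹) * u₀⁻¹)) (u₀ * u⁻¹)
  have e3 := nrm_mul_le (u₀ * u⁻¹)⁻¹ (u₀⁻¹⁻¹ * (v * v'⁻¹) * u₀⁻¹)
  rw [nrm_inv] at d3 e3
  have f1 := nrm_left_le v v'
  have f2 := nrm_right_le u u'
  rw [dist_def, c1, c2]
  linarith

end ScaledFree

namespace CompletedFree

open UniformSpace

variable {X : Type*} [MetricSpace X] {Γ : LetterScale X}

noncomputable instance : MetricSpace (CompletedFree Γ) :=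
  inferInstanceAs (MetricSpace (Completion (ScaledFree Γ)))

instance : CompleteSpace (CompletedFree Γ) :=
  inferInstanceAs (CompleteSpace (Completion (ScaledFree Γ)))

/-- The canonical map of `F_Γ(X)` to its completion. -/
noncomputable def of (u : ScaledFree Γ) : CompletedFree Γ := (u : Completion (ScaledFree Γ))

theorem isometry_of : Isometry (of : ScaledFree Γ → CompletedFree Γ) := Completion.coe_isometry

theorem dense_of : IsDenseInducing (of : ScaledFree Γ → CompletedFree Γ) :=
  Completion.isDenseInducing_coe

theorem dense_of_prod : IsDenseInducing
    (Prod.map of of : ScaledFree Γ × ScaledFree Γ → CompletedFree Γ × CompletedFree Γ) :=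
  dense_of.prodMap dense_of

theorem exists_mul_limit (p : CompletedFree Γ × CompletedFree Γ) :
    ∃ c : CompletedFree Γ, Tendsto (fun q : ScaledFree Γ × ScaledFree Γ => of (q.1 * q.2))
      (comap (Prod.map of of) (𝓝 p)) (𝓝 c) := by
  have hne := dense_of_prod.comap_nhds_neBot p
  suffices h : Cauchy (map (fun q : ScaledFree Γ × ScaledFree Γ => of (q.1 * q.2))
      (comap (Prod.map of of) (𝓝 p))) from CompleteSpace.complete h
  rw [Metric.cauchy_iff]
  refine ⟨hne.map _, fun ε hε => ?_⟩
  have ball_mem : ∀ r : ℝ, 0 < r → {q : ScaledFree Γ × ScaledFree Γ |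
      dist (of q.1) p.1 < r ∧ dist (of q.2) p.2 < r} ∈ comap (Prod.map of of) (𝓝 p) := by
    intro r hr
    refine ⟨Metric.ball p.1 r ×ˢ Metric.ball p.2 r,
      prod_mem_nhds (Metric.ball_mem_nhds _ hr) (Metric.ball_mem_nhds _ hr), ?_⟩
    rintro ⟨u, v⟩ ⟨h1, h2⟩
    exact ⟨h1, h2⟩
  obtain ⟨⟨u₀, v₀⟩, hu₀, hv₀⟩ := hne.nonempty_of_mem (ball_mem (ε / 16) (by positivity))
  obtain ⟨η, hη, h⟩ := ScaledFree.dist_mul_lt u₀ v₀ (show 0 < ε / 8 by positivity)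
  refine ⟨_, image_mem_map (ball_mem (min (η / 2) (ε / 16)) (by positivity)), ?_⟩
  rintro _ ⟨⟨u, v⟩, ⟨h1, h2⟩, rfl⟩ _ ⟨⟨u', v'⟩, ⟨h1', h2'⟩, rfl⟩
  simp only [lt_min_iff] at h1 h2 h1' h2' hu₀ hv₀
  rw [isometry_of.dist_eq]
  have := h u u' v v'
    (by rw [← isometry_of.dist_eq]; linarith [dist_triangle_right (of u₀) (of u) p.1])
    (by rw [← isometry_of.dist_eq]; linarith [dist_triangle_right (of v₀) (of v) p.2])
    (by rw [← isometry_of.dist_eq]; linarith [dist_triangle_right (of u) (of u') p.1])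
    (by rw [← isometry_of.dist_eq]; linarith [dist_triangle_right (of v) (of v') p.2])
  dsimp only
  linarith

/-- The multiplication of the completion: the continuous extension of that of `F_Γ(X)`. -/
noncomputable instance : Mul (CompletedFree Γ) where
  mul g h := dense_of_prod.extend
    (fun q : ScaledFree Γ × ScaledFree Γ => (of (q.1 * q.2) : CompletedFree Γ)) (g, h)

/-- The inverse of the completion: the continuous extension of that of `F_Γ(X)`. -/
noncomputable instance : Inv (CompletedFree Γ) where
  inv g := Completion.map (fun u : ScaledFree Γ => u⁻¹) g

noncomputable instance : One (CompletedFree Γ) where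
  one := of 1

theorem of_mul (u v : ScaledFree Γ) : (of (u * v) : CompletedFree Γ) = of u * of v :=
  (dense_of_prod.extend_eq' exists_mul_limit (u, v)).symm

theorem continuous_mul' : Continuous fun p : CompletedFree Γ × CompletedFree Γ => p.1 * p.2 :=
  dense_of_prod.continuous_extend exists_mul_limit

theorem of_inv (u : ScaledFree Γ) : (of u⁻¹ : CompletedFree Γ) = (of u)⁻¹ :=
  (Completion.map_coe (Isometry.of_dist_eq
    (ScaledFree.dist_inv_inv (Γ := Γ))).uniformContinuous u).symm

theorem continuous_inv' : Continuous fun g : CompletedFree Γ => g⁻¹ :=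
  Completion.continuous_map (f := fun u : ScaledFree Γ => u⁻¹)

noncomputable instance : Group (CompletedFree Γ) :=
  Group.ofLeftAxioms
    (by
      intro a b c
      refine Completion.induction_on₃ (α := ScaledFree Γ) a b c ?_ fun u v w => ?_
      · have hm := continuous_mul' (Γ := Γ)
        have h1 : Continuous fun x : CompletedFree Γ × CompletedFree Γ × CompletedFree Γ =>
            x.1 * x.2.1 * x.2.2 :=
          hm.comp ((hm.comp (continuous_fst.prodMk (continuous_fst.comp continuous_snd))).prodMk
            (continuous_snd.comp continuous_snd))
        have h2 : Continuous fun x : CompletedFree Γ × CompletedFree Γ × CompletedFree Γ =>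
            x.1 * (x.2.1 * x.2.2) :=
          hm.comp (continuous_fst.prodMk (hm.comp continuous_snd))
        exact isClosed_eq h1 h2
      · change of u * of v * of w = of u * (of v * of w)
        rw [← of_mul, ← of_mul, ← of_mul, ← of_mul, mul_assoc])
    (by
      intro a
      refine Completion.induction_on (α := ScaledFree Γ) a ?_ fun u => ?_
      · have hm := continuous_mul' (Γ := Γ)
        have h1 : Continuous fun x : CompletedFree Γ => 1 * x :=
          hm.comp (continuous_const.prodMk continuous_id)
        exact isClosed_eq h1 continuous_id
      · change of 1 * of u = of u
        rw [← of_mul, one_mul])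
    (by
      intro a
      refine Completion.induction_on (α := ScaledFree Γ) a ?_ fun u => ?_
      · have hm := continuous_mul' (Γ := Γ)
        have h1 : Continuous fun x : CompletedFree Γ => x⁻¹ * x :=
          hm.comp (continuous_inv'.prodMk continuous_id)
        exact isClosed_eq h1 continuous_const
      · change (of u)⁻¹ * of u = of 1
        rw [← of_inv, ← of_mul, inv_mul_cancel])

instance : IsTopologicalGroup (CompletedFree Γ) where
  continuous_mul := continuous_mul'
  continuous_inv := continuous_inv'

/-- The canonical map of `F_Γ(X)` to its completion as a group homomorphism. -/
noncomputable def ofHom : ScaledFree Γ →* CompletedFree Γ where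
  toFun := of
  map_one' := rfl
  map_mul' := of_mul

/-- The canonical map of `X` to the completion of `F_Γ(X)`. -/
noncomputable def gen (x : X) : CompletedFree Γ :=
  of ((ScaledFree.equiv Γ).symm (FreeGroup.of x))

theorem nrm_pair (a b : Letter X) :
    (scaleNorm Γ (a⁻¹.toFree * b.toFree) : ℝ) ≤ Letter.d a b := by
  have h := scaleNorm_le Γ (MatchCost.wrap a b (MatchCost.nil (Γ := Γ)))
  have h0 : ∀ x, Γ.toFun x 0 = 0 := fun x => (Γ.eq_zero_iff x 0).2 rfl
  simp only [h0, max_self, add_zero, List.nil_append, wordVal_cons, wordVal_nil, mul_one] at h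
  exact_mod_cast h

theorem dist_gen_le (x y : X) :
    dist (gen x : CompletedFree Γ) (gen y) ≤ 2 * dist x y := by
  have h1 := nrm_pair (Γ := Γ) (.pos x) (.pos y)
  have h2 := nrm_pair (Γ := Γ) (.neg x) (.neg y)
  have h3 : dist (gen x : CompletedFree Γ) (gen y) =
      (scaleNorm Γ ((FreeGroup.of x)⁻¹ * FreeGroup.of y) : ℝ) +
      scaleNorm Γ (FreeGroup.of x * (FreeGroup.of y)⁻¹) := by
    rw [gen, gen, isometry_of.dist_eq, ScaledFree.dist_def]
    rfl
  have h4 : (Letter.d (.pos x) (.pos y) : ℝ) = dist x y := rfl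
  have h5 : (Letter.d (.neg x) (.neg y) : ℝ) = dist x y := rfl
  have h6 : (Letter.pos x)⁻¹.toFree * (Letter.pos y).toFree =
      (FreeGroup.of x)⁻¹ * FreeGroup.of y := rfl
  have h7 : (Letter.neg x)⁻¹.toFree * (Letter.neg y).toFree =
      FreeGroup.of x * (FreeGroup.of y)⁻¹ := rfl
  rw [h4, h6] at h1
  rw [h5, h7] at h2
  linarith

theorem continuous_gen : Continuous (gen : X → CompletedFree Γ) :=
  (LipschitzWith.of_dist_le_mul (K := 2) dist_gen_le).continuous

instance [TopologicalSpace.SeparableSpace X] :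
    TopologicalSpace.SeparableSpace (CompletedFree Γ) := by
  obtain ⟨D, hD, hd⟩ := TopologicalSpace.exists_countable_dense X
  have : Countable D := hD.to_subtype
  let φ : FreeGroup D →* CompletedFree Γ := FreeGroup.lift fun x => gen x.1
  let S : Subgroup (CompletedFree Γ) := φ.range.topologicalClosure
  have h1 : ∀ x : X, gen x ∈ S := by
    intro x
    have h2 : gen '' closure D ⊆ (S : Set (CompletedFree Γ)) := by
      refine (image_closure_subset_closure_image continuous_gen).trans (closure_mono ?_)
      rintro _ ⟨y, hy, rfl⟩
      exact ⟨FreeGroup.of ⟨y, hy⟩, by simp [φ]⟩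
    exact h2 ⟨x, hd x, rfl⟩
  have h3 : ∀ u : FreeGroup X, ofHom ((ScaledFree.equiv Γ).symm u) ∈ S := fun u => by
    refine FreeGroup.induction_on u ?_ (fun x => h1 x) (fun x h => ?_) (fun x y hx hy => ?_)
    · rw [map_one, map_one]
      exact S.one_mem
    · rw [map_inv, map_inv]
      exact S.inv_mem h
    · rw [map_mul, map_mul]
      exact S.mul_mem hx hy
  refine ⟨⟨range φ, countable_range φ, fun g => ?_⟩⟩
  have h4 : closure (range (of : ScaledFree Γ → CompletedFree Γ)) ⊆ S :=
    closure_minimal (by rintro _ ⟨u, rfl⟩; exact h3 u)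
      (Subgroup.isClosed_topologicalClosure _)
  exact h4 (dense_of.dense g)

instance [TopologicalSpace.SeparableSpace X] : PolishSpace (CompletedFree Γ) := by
  have := UniformSpace.secondCountable_of_separable (CompletedFree Γ)
  infer_instance

end CompletedFree

/-! ### The Baire space and regular scales -/

/-- The Baire space `ℕ^ℕ`. -/
def BaireSeq : Type := ℕ → ℕ

namespace BaireSeq

/-- The classical metric of the Baire space: `d (x, y) = 2⁻ⁿ` for the first `n` such that
`x n ≠ y n`. -/
noncomputable instance : MetricSpace BaireSeq := PiNat.metricSpaceNatNat

/-- The distance of `x ≠ y` is the maximum of all `2⁻ⁿ` with `x n ≠ y n`. -/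
theorem isGreatest_dist {x y : BaireSeq} (h : x ≠ y) :
    IsGreatest {r : ℝ | ∃ n : ℕ, x n ≠ y n ∧ r = (1 / 2) ^ n} (dist x y) := by
  have e : dist x y = (1 / 2 : ℝ) ^ PiNat.firstDiff x y := PiNat.dist_eq_of_ne h
  refine ⟨⟨_, PiNat.apply_firstDiff_ne h, e⟩, ?_⟩
  rintro _ ⟨n, hn, rfl⟩
  rw [e]
  refine pow_le_pow_of_le_one (by norm_num) (by norm_num) ?_
  by_contra hc
  exact hn (PiNat.apply_eq_of_lt_firstDiff (not_le.1 hc))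

instance : TopologicalSpace.SeparableSpace BaireSeq :=
  inferInstanceAs (TopologicalSpace.SeparableSpace (ℕ → ℕ))

/-- `π_n (x)` agrees with `x` below `n` and is `0` from `n` on. -/
def trunc (n : ℕ) (x : BaireSeq) : BaireSeq := fun m => if m < n then x m else 0

end BaireSeq

/-- A scale `Γ` on the alphabet over the Baire space is regular if
`Γ (π_n (x), r) ≤ Γ (x, r)` for all letters `x`, all `n` and all `r ≥ 0`, where
`π_n (x⁻¹) = π_n (x)⁻¹` and `π_n (e) = e`. -/
def LetterScale.IsRegular (Γ : LetterScale BaireSeq) : Prop :=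
  ∀ (x : Letter BaireSeq) (r : ℝ≥0) (n : ℕ),
    Γ.toFun (x.map (BaireSeq.trunc n)) r ≤ Γ.toFun x r

/-! ### Universal Polish groups -/

/-- A Polish group `G` is universal if every Polish group is continuously embedded in `G` as a
closed subgroup. -/
def IsUniversalPolishGroup (G : Type) [Group G] [TopologicalSpace G] [IsTopologicalGroup G]
    [PolishSpace G] : Prop :=
  ∀ (H : Type) [Group H] [TopologicalSpace H] [IsTopologicalGroup H] [PolishSpace H],
    ∃ f : H →* G, Continuous f ∧ Function.Injective f ∧ IsClosed (range f)

/-! The completion is totally disconnected, while ℝ is connected. The truncation π_n induces an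
endomorphism of the free group, and two estimates for it carry the proof. It does not increase N_Γ
(`scaleNorm_map_trunc_le`): truncating all letters of a matched word shrinks the distances and, by
regularity, the values of Γ. Its range is discrete at scale 2⁻ⁿ
(`map_trunc_eq_one_of_scaleNorm_lt`): since Γ(x, r) ≥ r, the cost of a match bounds d(x, y) for
every matched pair x⁻¹, y and d(e, x) for every letter x matched with itself; at a cost below 2⁻ⁿ
these letters agree after truncation, and the truncated word cancels to 1.

By the first estimate the endomorphisms extend to 1-Lipschitz maps `truncMap` of the completion, and
these converge pointwise to the identity (`tendsto_truncMap`). By the second, two points in the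
range of the n-th map have distance 0 or at least 2⁻ⁿ (`truncMap_eq_of_dist_lt`). A continuous map
of a connected space, followed by the n-th truncation, is therefore locally constant, hence
constant; letting n → ∞, the map itself is constant (`eq_of_continuous`). So a continuous
homomorphism from ℝ is never injective. -/

namespace BaireSeq

/-! ### Truncation on the Baire space -/

theorem trunc_eq_of_dist_lt {x y : BaireSeq} {n : ℕ} (h : dist x y < (1 / 2) ^ n) :
    trunc n x = trunc n y := by
  rcases eq_or_ne x y with rfl | hne
  · rfl
  funext m
  by_cases hm : m < n
  · have hxy : x m = y m := by
      by_contra hc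
      have h1 : (1 / 2 : ℝ) ^ m ≤ dist x y := (isGreatest_dist hne).2 ⟨m, hc, rfl⟩
      have h2 : (1 / 2 : ℝ) ^ n ≤ (1 / 2) ^ m :=
        pow_le_pow_of_le_one (by norm_num) (by norm_num) hm.le
      linarith
    simp [trunc, hm, hxy]
  · simp [trunc, hm]

theorem trunc_trunc (n : ℕ) (x : BaireSeq) : trunc n (trunc n x) = trunc n x := by
  funext m
  by_cases hm : m < n <;> simp [trunc, hm]

/-- A position where the truncations differ is one where the sequences themselves differ. -/
theorem dist_trunc_trunc_le (n : ℕ) (x y : BaireSeq) :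
    dist (trunc n x) (trunc n y) ≤ dist x y := by
  rcases eq_or_ne (trunc n x) (trunc n y) with h | h
  · rw [h, dist_self]
    exact dist_nonneg
  obtain ⟨m, hm, he⟩ := (isGreatest_dist h).1
  rw [he]
  have hxy : x m ≠ y m := by
    intro hc
    exact hm (by simp [trunc, hc])
  exact (isGreatest_dist fun hc => hxy (by rw [hc])).2 ⟨m, hxy, rfl⟩

theorem dist_trunc_le (n : ℕ) (x : BaireSeq) : dist (trunc n x) x ≤ (1 / 2) ^ n := by
  rcases eq_or_ne (trunc n x) x with h | h
  · rw [h, dist_self]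
    positivity
  obtain ⟨m, hm, he⟩ := (isGreatest_dist h).1
  rw [he]
  refine pow_le_pow_of_le_one (by norm_num) (by norm_num) ?_
  by_contra hc
  exact hm (by simp [trunc, not_le.1 hc])

theorem tendsto_trunc (x : BaireSeq) : Tendsto (fun n => trunc n x) atTop (𝓝 x) :=
  tendsto_iff_dist_tendsto_zero.2 <| squeeze_zero (fun _ => dist_nonneg)
    (fun n => dist_trunc_le n x) (tendsto_pow_atTop_nhds_zero_of_lt_one (by norm_num) (by norm_num))

end BaireSeq

open BaireSeq (trunc)

/-! ### Truncation of letters, matched words and the norm -/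

theorem Letter.map_inv {X Y : Type*} (f : X → Y) (x : Letter X) : (x⁻¹).map f = (x.map f)⁻¹ := by
  cases x <;> rfl

theorem Letter.toFree_map {X Y : Type*} (f : X → Y) (x : Letter X) :
    (x.map f).toFree = FreeGroup.map f x.toFree := by
  cases x <;> simp [Letter.map, Letter.toFree]

theorem wordVal_map {X Y : Type*} (f : X → Y) (w : List (Letter X)) :
    wordVal (w.map (Letter.map f)) = FreeGroup.map f (wordVal w) := by
  induction w with
  | nil => simp
  | cons a w ih => simp [ih, Letter.toFree_map]

theorem Letter.d_map_trunc_le (n : ℕ) (x y : Letter BaireSeq) :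
    Letter.d (x.map (trunc n)) (y.map (trunc n)) ≤ Letter.d x y := by
  cases x <;> cases y <;> simp only [Letter.map, Letter.d, le_refl]
  all_goals exact BaireSeq.dist_trunc_trunc_le n _ _

/-- Letters of different kinds have distance 1 ≥ 2⁻ⁿ, so two letters this close are of the same kind
and agree below n, or are both e. -/
theorem Letter.map_trunc_eq_of_d_lt {n : ℕ} {x y : Letter BaireSeq}
    (h : Letter.d x y < (1 / 2) ^ n) : x.map (trunc n) = y.map (trunc n) := by
  have h1 : ¬ ((1 : ℝ≥0) < (1 / 2) ^ n) := not_lt.2 (pow_le_one' (by simp) n)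
  have h2 : ∀ a b : BaireSeq, nndist a b < (1 / 2) ^ n → trunc n a = trunc n b := fun a b hab =>
    BaireSeq.trunc_eq_of_dist_lt (by exact_mod_cast NNReal.coe_lt_coe.2 hab)
  cases x <;> cases y <;> simp only [Letter.d, Letter.map] at h ⊢
  all_goals first | exact absurd h h1 | rw [h2 _ _ h]

/-- The same match is kept and every letter truncated. This is where regularity enters: it bounds Γ
at the truncated letters of a wrapping pair, and monotonicity of Γ absorbs the drop in the inner
cost. -/
theorem MatchCost.exists_map_trunc_le {Γ : LetterScale BaireSeq} (hΓ : Γ.IsRegular) (n : ℕ)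
    {w : List (Letter BaireSeq)} {c : ℝ≥0} (h : MatchCost Γ w c) :
    ∃ c' ≤ c, MatchCost Γ (w.map (Letter.map (trunc n))) c' := by
  induction h with
  | nil => exact ⟨0, le_rfl, .nil⟩
  | single x => exact ⟨_, Letter.d_map_trunc_le n .e x, .single _⟩
  | app _ _ ihv ihw =>
    obtain ⟨a, ha, h1⟩ := ihv
    obtain ⟨b, hb, h2⟩ := ihw
    rw [List.map_append]
    exact ⟨_, add_le_add ha hb, h1.app h2⟩
  | wrap x y _ ih =>
    obtain ⟨a, ha, h1⟩ := ih
    refine ⟨_, add_le_add (Letter.d_map_trunc_le n x y) (max_le_max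
      ((hΓ x a n).trans (Γ.mono x ha)) ((hΓ y a n).trans (Γ.mono y ha))), ?_⟩
    simpa [Letter.map_inv] using h1.wrap (x.map (trunc n)) (y.map (trunc n))

/-- The cost dominates the cost of each subword and each distance between partners, so below 2⁻ⁿ all
partners become formal inverses after truncation and the word cancels from the inside out. -/
theorem MatchCost.wordVal_map_trunc_eq_one {Γ : LetterScale BaireSeq} {n : ℕ}
    {w : List (Letter BaireSeq)} {c : ℝ≥0} (h : MatchCost Γ w c) (hc : c < (1 / 2) ^ n) :
    wordVal (w.map (Letter.map (trunc n))) = 1 := by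
  induction h with
  | nil => rfl
  | single x =>
    -- A letter matched with itself is closer than 2⁻ⁿ to e, so its truncation is that of e.
    rw [List.map_singleton, ← Letter.map_trunc_eq_of_d_lt hc, wordVal_cons, wordVal_nil, mul_one]
    rfl
  | app _ _ ihv ihw =>
    rw [List.map_append, wordVal_append, ihv (le_self_add.trans_lt hc),
      ihw (le_add_self.trans_lt hc), one_mul]
  | @wrap w a x y _ ih =>
    have h1 := Letter.map_trunc_eq_of_d_lt (le_self_add.trans_lt hc)
    -- The inner cost satisfies a ≤ Γ(x, a), so it also lies below 2⁻ⁿ.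
    have h2 := ih (((Γ.le_self x a).trans ((le_max_left _ _).trans le_add_self)).trans_lt hc)
    simp [Letter.map_inv, h1, h2]

theorem scaleNorm_map_trunc_le {Γ : LetterScale BaireSeq} (hΓ : Γ.IsRegular) (n : ℕ)
    (u : FreeGroup BaireSeq) : scaleNorm Γ (FreeGroup.map (trunc n) u) ≤ scaleNorm Γ u := by
  refine le_of_forall_gt fun r hr => ?_
  obtain ⟨w, c, h, rfl, l⟩ := exists_matchCost_lt Γ hr
  obtain ⟨c', hc', h'⟩ := h.exists_map_trunc_le hΓ n
  rw [← wordVal_map]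
  exact (scaleNorm_le Γ h').trans_lt (hc'.trans_lt l)

/-- The free group on the truncated sequences is discrete with respect to `N_Γ`. -/
theorem map_trunc_eq_one_of_scaleNorm_lt {Γ : LetterScale BaireSeq} {n : ℕ}
    {u : FreeGroup BaireSeq} (h : scaleNorm Γ (FreeGroup.map (trunc n) u) < (1 / 2) ^ n) :
    FreeGroup.map (trunc n) u = 1 := by
  obtain ⟨w, c, hw, e, l⟩ := exists_matchCost_lt Γ h
  have h1 := hw.wordVal_map_trunc_eq_one l
  -- A cheap word for the truncated element may use untruncated letters. Truncating them gives a
  -- word with value 1, which by idempotence still represents the same element.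
  have h2 : trunc n ∘ trunc n = trunc n := funext (BaireSeq.trunc_trunc n)
  rwa [wordVal_map, e, FreeGroup.map.comp, h2] at h1

/-! ### Truncation as an endomorphism of the free group -/

namespace ScaledFree

/-- The endomorphism of `F_Γ(𝒩)` induced by the truncation `π_n`. -/
def truncHom (Γ : LetterScale BaireSeq) (n : ℕ) : ScaledFree Γ →* ScaledFree Γ :=
  FreeGroup.map (trunc n)

variable {Γ : LetterScale BaireSeq}

theorem lipschitzWith_truncHom (hΓ : Γ.IsRegular) (n : ℕ) : LipschitzWith 1 (truncHom Γ n) := by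
  have key : ∀ u : ScaledFree Γ, nrm (truncHom Γ n u) ≤ nrm u := fun u =>
    NNReal.coe_le_coe.2 (scaleNorm_map_trunc_le hΓ n u)
  refine LipschitzWith.of_dist_le_mul fun u v => ?_
  rw [dist_def, dist_def, NNReal.coe_one, one_mul, ← map_inv, ← map_inv, ← map_mul, ← map_mul]
  exact add_le_add (key _) (key _)

theorem truncHom_eq_of_dist_lt {n : ℕ} {u v : ScaledFree Γ}
    (h : dist (truncHom Γ n u) (truncHom Γ n v) < (1 / 2) ^ n) :
    truncHom Γ n u = truncHom Γ n v := by
  have h1 := (nrm_left_le _ _).trans_lt h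
  rw [← map_inv, ← map_mul] at h1
  -- The distance is a sum of two norms; smallness of the left one already suffices.
  have h2 : truncHom Γ n (u⁻¹ * v) = 1 :=
    map_trunc_eq_one_of_scaleNorm_lt (Γ := Γ) (by
      rw [← NNReal.coe_lt_coe]
      push_cast
      exact h1)
  rw [map_mul, map_inv] at h2
  exact inv_mul_eq_one.1 h2

end ScaledFree

/-! ### Truncation on the completion, and total disconnectedness -/

namespace CompletedFree

open UniformSpace

variable {Γ : LetterScale BaireSeq}

/-- The elements with this property form a subgroup, because the operations of the completion are
continuous. It contains the generators, since π_n(x) → x and `gen` is continuous. -/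
theorem tendsto_of_truncHom (u : ScaledFree Γ) :
    Tendsto (fun n => (of (ScaledFree.truncHom Γ n u) : CompletedFree Γ)) atTop (𝓝 (of u)) := by
  change Tendsto (fun n => ofHom (ScaledFree.truncHom Γ n u)) atTop (𝓝 (ofHom u))
  have hgen : ∀ x : BaireSeq, Tendsto (fun n => ofHom (ScaledFree.truncHom Γ n
      ((ScaledFree.equiv Γ).symm (FreeGroup.of x)))) atTop
      (𝓝 (ofHom ((ScaledFree.equiv Γ).symm (FreeGroup.of x)))) := fun x =>
    ((continuous_gen (Γ := Γ)).tendsto x).comp (BaireSeq.tendsto_trunc x)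
  suffices h : ∀ u : FreeGroup BaireSeq, Tendsto (fun n => ofHom (ScaledFree.truncHom Γ n
      ((ScaledFree.equiv Γ).symm u))) atTop (𝓝 (ofHom ((ScaledFree.equiv Γ).symm u))) from h u
  intro u
  refine FreeGroup.induction_on u ?_ hgen (fun x h => ?_) (fun x y hx hy => ?_)
  · simp only [map_one]
    exact tendsto_const_nhds
  · simp only [map_inv]
    exact h.inv
  · simp only [map_mul]
    exact hx.mul hy

/-- The continuous extension to the completion of the endomorphism induced by `π_n`. -/
noncomputable def truncMap (Γ : LetterScale BaireSeq) (n : ℕ) :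
    CompletedFree Γ → CompletedFree Γ :=
  Completion.map (ScaledFree.truncHom Γ n)

theorem truncMap_of (hΓ : Γ.IsRegular) (n : ℕ) (u : ScaledFree Γ) :
    truncMap Γ n (of u) = of (ScaledFree.truncHom Γ n u) :=
  Completion.map_coe (ScaledFree.lipschitzWith_truncHom hΓ n).uniformContinuous u

theorem continuous_truncMap (n : ℕ) : Continuous (truncMap Γ n) :=
  Completion.continuous_map

theorem dist_truncMap_le (hΓ : Γ.IsRegular) (n : ℕ) (g h : CompletedFree Γ) :
    dist (truncMap Γ n g) (truncMap Γ n h) ≤ dist g h := by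
  have := (ScaledFree.lipschitzWith_truncHom hΓ n).completion_map.dist_le_mul g h
  rwa [NNReal.coe_one, one_mul] at this

/-- The truncations are uniformly 1-Lipschitz, so convergence passes from the dense free group to
its completion by an ε/3 argument. -/
theorem tendsto_truncMap (hΓ : Γ.IsRegular) (g : CompletedFree Γ) :
    Tendsto (fun n => truncMap Γ n g) atTop (𝓝 g) := by
  refine Metric.tendsto_atTop.2 fun ε hε => ?_
  obtain ⟨u, hu⟩ := dense_of.dense.exists_dist_lt g (show 0 < ε / 3 by positivity)
  obtain ⟨N, hN⟩ := Metric.tendsto_atTop.1 (tendsto_of_truncHom u) (ε / 3) (by positivity)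
  refine ⟨N, fun n hn => ?_⟩
  have h1 := dist_truncMap_le hΓ n g (of u)
  have h2 := hN n hn
  rw [← truncMap_of hΓ] at h2
  have h3 := dist_triangle4_right (truncMap Γ n g) g (truncMap Γ n (of u)) (of u)
  linarith

theorem truncMap_eq_of_dist_lt (hΓ : Γ.IsRegular) {n : ℕ} {g h : CompletedFree Γ}
    (hd : dist (truncMap Γ n g) (truncMap Γ n h) < (1 / 2) ^ n) :
    truncMap Γ n g = truncMap Γ n h := by
  -- The gap is restated as membership of the distance in a closed set, a condition that extends
  -- from the dense free group to the completion.
  suffices H : dist (truncMap Γ n g) (truncMap Γ n h) ∈ ({0} ∪ Ici ((1 / 2) ^ n) : Set ℝ) by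
    rcases H with H | H
    · exact dist_eq_zero.1 H
    · exact absurd hd (not_lt.2 H)
  refine Completion.induction_on₂ (α := ScaledFree Γ) (β := ScaledFree Γ) g h ?_ fun u v => ?_
  · exact (isClosed_singleton.union isClosed_Ici).preimage
      (((continuous_truncMap n).comp continuous_fst).dist
        ((continuous_truncMap n).comp continuous_snd))
  · change dist (truncMap Γ n (of u)) (truncMap Γ n (of v)) ∈ _
    rw [truncMap_of hΓ, truncMap_of hΓ, isometry_of.dist_eq]
    rcases lt_or_ge (dist (ScaledFree.truncHom Γ n u) (ScaledFree.truncHom Γ n v))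
      ((1 / 2) ^ n) with h1 | h1
    · left
      rw [ScaledFree.truncHom_eq_of_dist_lt h1, dist_self]
      rfl
    · exact Or.inr h1

/-- A continuous map of a connected space to the completion is constant. -/
theorem eq_of_continuous (hΓ : Γ.IsRegular) {T : Type*} [TopologicalSpace T]
    [PreconnectedSpace T] {f : T → CompletedFree Γ} (hf : Continuous f) (s t : T) :
    f s = f t := by
  have key : ∀ n, truncMap Γ n (f s) = truncMap Γ n (f t) := fun n => by
    have hc : Continuous fun t => truncMap Γ n (f t) := (continuous_truncMap n).comp hf
    -- Nearby parameters have truncated values closer than 2⁻ⁿ, hence equal ones.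
    have hl : IsLocallyConstant fun t => truncMap Γ n (f t) := by
      refine (IsLocallyConstant.iff_eventually_eq _).2 fun r => ?_
      filter_upwards [hc.continuousAt.eventually (Metric.ball_mem_nhds _
        (show (0 : ℝ) < (1 / 2) ^ n by positivity))] with q hq
      exact truncMap_eq_of_dist_lt hΓ hq
    exact hl.apply_eq_of_preconnectedSpace s t
  -- The two sequences of truncations coincide, so their limits f s and f t do.
  exact tendsto_nhds_unique (tendsto_truncMap hΓ (f s))
    ((tendsto_truncMap hΓ (f t)).congr fun n => (key n).symm)

end CompletedFree

/-! ### The real line does not embed -/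

theorem mainTheorem4 (Γ : LetterScale BaireSeq) (hΓ : Γ.IsRegular) :
    ¬ IsUniversalPolishGroup (CompletedFree Γ) ∧
      ¬ ∃ f : Multiplicative ℝ →* CompletedFree Γ, Continuous f ∧ Function.Injective f := by
  have key : ¬ ∃ f : Multiplicative ℝ →* CompletedFree Γ,
      Continuous f ∧ Function.Injective f := by
    rintro ⟨f, hf, hi⟩
    have : PreconnectedSpace (Multiplicative ℝ) := inferInstanceAs (PreconnectedSpace ℝ)
    have h : Multiplicative.ofAdd (0 : ℝ) = Multiplicative.ofAdd 1 :=
      hi (CompletedFree.eq_of_continuous hΓ hf _ _)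
    exact zero_ne_one (Multiplicative.ofAdd.injective h)
  -- Universality applied to the Polish group ℝ would give the excluded homomorphism; closedness of
  -- its range plays no role.
  refine ⟨fun h => key ?_, key⟩
  have : PolishSpace (Multiplicative ℝ) := inferInstanceAs (PolishSpace ℝ)
  obtain ⟨f, hf, hi, -⟩ := h (Multiplicative ℝ)
  exact ⟨f, hf, hi⟩
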